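/- Let $0<\sigma<1$, $c>-\sigma$, $\alpha>0$. Let $\mu=\sum_{i\ge1}\mu_i\delta_{\theta_i}$ be a stable beta process $\mathrm{SB}(c,\sigma,\alpha)$: the weights $\mu_i$ are the points of a Poisson process on $(0,1]$ with intensity (Lévy measure) $$\nu(dx)=\alpha\,\frac{\Gamma(1+c)}{\Gamma(1-\sigma)\Gamma(c+\sigma)}\,x^{-\sigma-1}(1-x)^{c+\sigma-1}\,dx ,$$ and the locations $\theta_i$, which represent the potential vertices, are independent draws from an atomless probability distribution $H$ on a standard Borel space, independent of the weights. Given $\mu$, let $(Z_{ni})_{n,i\ge1}$ be independent with $Z_{ni}\sim\mathrm{Bernoulli}(\mu_i)$ (marginally, the rows of $Z$ form a stable-beta Indian buffet process, SB-IBP). The $n$-th clique is $\mathcal C_n=\{\theta_i: Z_{ni}=1\}$, and the vertex set of the random clique cover graph with $N$ cliques is $V_N=\mathcal C_1\cup\dots\cup\mathcal C_N$. Then the number of vertices grows as $N^\sigma$ as $N\to\infty$: almost surely, $|V_N|$ is finite for every $N$ and $$|V_N|\sim\frac{\alpha}{\sigma}\,\frac{\Gamma(c+1)}{\Gamma(c+\sigma)}\,N^\sigma\qquad(N\to\infty).$$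 Moreover, $\mathbb E|V_N|$ and the expected number of non-zero columns of the $N$-row SB-IBP matrix $(Z_{ni})_{n\le N,\,i\ge1}$ are finite for every $N$, and each of them is asymptotic to $$\frac{\alpha}{\sigma}\,\frac{\Gamma(c+1)}{\Gamma(c+\sigma)}\,N^\sigma\qquad(N\to\infty).$$ -/

import Mathlib

open MeasureTheory ProbabilityTheory Filter Asymptotics
open scoped ENNReal Topology

noncomputable section

namespace RandomCliqueCover

/-- The Lévy measure of the stable beta process `SB(c, σ, α)`, a measure on `(0, 1]`
(regarded as a measure on `ℝ`):
`α Γ(1+c) / (Γ(1-σ) Γ(c+σ)) * x^(-σ-1) * (1-x)^(c+σ-1) dx`. -/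
def stableBetaLevy (c σ α : ℝ) : Measure ℝ :=
  (volume.restrict (Set.Ioc (0 : ℝ) 1)).withDensity fun x =>
    ENNReal.ofReal
      (α * (Real.Gamma (1 + c) / (Real.Gamma (1 - σ) * Real.Gamma (c + σ)))
        * x ^ (-σ - 1) * (1 - x) ^ (c + σ - 1))

variable {Ω : Type*} [MeasurableSpace Ω]

/-- The number of points of the random sequence `X` that fall in `B`. -/
def pointCount {E : Type*} (X : ℕ → Ω → E) (B : Set E) (ω : Ω) : ℕ∞ :=
  {i : ℕ | X i ω ∈ B}.encard

/-- The random sequence `X` enumerates the points of a Poisson process with (σ-finite, infinite)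
intensity measure `ν`: the number of points in a measurable set `B` of finite intensity has the
Poisson distribution with mean `ν B`, and the numbers of points in finitely many pairwise disjoint
measurable sets are independent. -/
structure IsPoissonProcess {E : Type*} [MeasurableSpace E] (ν : Measure E) (P : Measure Ω)
    (X : ℕ → Ω → E) : Prop where
  measurable : ∀ i, Measurable (X i)
  law_count : ∀ B : Set E, MeasurableSet B → ν B ≠ ∞ →
    P.map (pointCount X B) = (poissonMeasure (ν B).toNNReal).map ((↑) : ℕ → ℕ∞)
  indep_count : ∀ (k : ℕ) (B : Fin k → Set E), (∀ j, MeasurableSet (B j)) →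
    Pairwise (fun j l => Disjoint (B j) (B l)) →
    iIndepFun (fun j => pointCount X (B j)) P

/-- The atoms `(w i, θ i)` of a stable beta process `∑ i, w i • δ_{θ i}` with parameters
`(c, σ, α)` and base distribution `H` on the space `𝒱` of potential vertices: the weights are the
points of a Poisson process whose intensity is the Lévy measure, and the locations are
independent draws from `H`, independent of the weights. -/
structure IsStableBetaProcess {𝒱 : Type*} [MeasurableSpace 𝒱] (c σ α : ℝ) (H : Measure 𝒱)
    (P : Measure Ω) (w : ℕ → Ω → ℝ) (θ : ℕ → Ω → 𝒱) : Prop where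
  weights : IsPoissonProcess (stableBetaLevy c σ α) P w
  measurable_location : ∀ i, Measurable (θ i)
  law_location : ∀ i, P.map (θ i) = H
  iIndep_location : iIndepFun θ P
  indep : IndepFun (fun ω i => w i ω) (fun ω i => θ i ω) P

/-- `Z` is the binary matrix (with `true` for `1`) of the cliques drawn from the atoms `(w, θ)`:
conditionally on all the atoms, the entries `Z n i` are independent and `Z n i = 1` with
probability `w i`. The conditional law is expressed by integrating it over every event `A` that is
determined by the atoms. With `(w, θ)` a stable beta process, the law of the rows of `Z` is the
stable-beta Indian buffet process. -/
structure IsCliqueMatrix {𝒱 : Type*} [MeasurableSpace 𝒱] (P : Measure Ω) (w : ℕ → Ω → ℝ)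
    (θ : ℕ → Ω → 𝒱) (Z : ℕ → ℕ → Ω → Bool) : Prop where
  measurable : ∀ n i, Measurable (Z n i)
  cond_law : ∀ (S : Finset (ℕ × ℕ)) (z : ℕ × ℕ → Bool) (A : Set (ℕ → ℝ × 𝒱)), MeasurableSet A →
    P {ω | (fun i => (w i ω, θ i ω)) ∈ A ∧ ∀ p ∈ S, Z p.1 p.2 ω = z p} =
      ∫⁻ ω in {ω | (fun i => (w i ω, θ i ω)) ∈ A},
        ∏ p ∈ S, ENNReal.ofReal (if z p = true then w p.2 ω else 1 - w p.2 ω) ∂P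

/-- The `n`-th clique: the set of the vertices `θ i` with `Z n i = 1`. -/
def clique {𝒱 : Type*} (θ : ℕ → Ω → 𝒱) (Z : ℕ → ℕ → Ω → Bool) (n : ℕ) (ω : Ω) : Set 𝒱 :=
  {v | ∃ i, Z n i ω = true ∧ θ i ω = v}

/-- The vertex set of the graph generated by the first `N` cliques: a potential vertex is a vertex
of the graph iff it belongs to at least one of these cliques. -/
def vertexSet {𝒱 : Type*} (θ : ℕ → Ω → 𝒱) (Z : ℕ → ℕ → Ω → Bool) (N : ℕ) (ω : Ω) : Set 𝒱 :=
  {v | ∃ n < N, v ∈ clique θ Z n ω}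

/-- The (indices of the) non-zero columns of the first `N` rows of `Z`. -/
def nonzeroColumns (Z : ℕ → ℕ → Ω → Bool) (N : ℕ) (ω : Ω) : Set ℕ :=
  {i | ∃ n < N, Z n i ω = true}

/-- The constant `(α / σ) Γ(c+1) / Γ(c+σ)`. -/
def growthConst (c σ α : ℝ) : ℝ :=
  α / σ * (Real.Gamma (c + 1) / Real.Gamma (c + σ))

end RandomCliqueCover

end

/-!
Write `K N` for the number of non-zero columns of the first `N` rows. The locations are independent
draws from an atomless law, so they are almost surely distinct
(`ae_injective_of_iIndepFun`), and the vertex set has exactly `K N` elements.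

Given the weights, column `i` is non-zero with probability `1 - (1 - w i) ^ N`, independently for
distinct `i`. Campbell's formula (`IsPoissonProcess.sum_map_eq`) gives
`𝔼 K N = ∫ (1 - (1 - x) ^ N) ν(dx)`, which is a finite sum of Beta integrals; it telescopes to a
difference of Gamma ratios (`sum_Gamma_div_Gamma`), and log-convexity of `Γ` yields the power law
`N ^ σ` (`tendsto_meanColumns_div`).

The second factorial moment measure of a Poisson process is the product `ν × ν`
(`IsPoissonProcess.sum_map_prod_eq`). Hence the variance of `K N` is equal to its mean
(`IsCliqueMatrix.lintegral_ncard_nonzeroColumns_sub_sq`), and the relative variance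
`1 / 𝔼 K N` is summable along `N = k ^ p` as soon as `p σ ≥ 2`. Then `K N / 𝔼 K N → 1` almost surely
along this subsequence, and since `K` is monotone and `(k + 1) ^ p / k ^ p → 1`, the power law
extends to all `N` (`tendsto_div_rpow_of_monotone`).
-/

namespace RandomCliqueCover

/-! ### Moments of the Poisson distribution -/

/-- The Chen–Stein identity, from which all moments of the Poisson distribution follow. -/
lemma lintegral_natCast_mul_poissonMeasure (r : NNReal) (f : ℕ → ℝ≥0∞) :
    ∫⁻ n, (n : ℝ≥0∞) * f n ∂(poissonMeasure r) = r * ∫⁻ n, f (n + 1) ∂(poissonMeasure r) := by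
  simp only [poissonMeasure, lintegral_sum_measure, lintegral_smul_measure, lintegral_dirac,
    smul_eq_mul]
  rw [tsum_eq_zero_add' ENNReal.summable, ← ENNReal.tsum_mul_left]
  simp only [Nat.cast_zero, zero_mul, mul_zero, zero_add]
  refine tsum_congr fun n => ?_
  have h : ENNReal.ofReal (Real.exp (-r) * r ^ (n + 1) / (n + 1).factorial) * ((n + 1 : ℕ) : ℝ≥0∞)
      = r * ENNReal.ofReal (Real.exp (-r) * r ^ n / n.factorial) := by
    rw [← ENNReal.ofReal_natCast (n + 1), ← ENNReal.ofReal_mul (by positivity),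
      ← ENNReal.ofReal_coe_nnreal, ← ENNReal.ofReal_mul (by positivity)]
    congr 1
    rw [Nat.factorial_succ]
    push_cast
    field_simp
    exact pow_succ' _ _
  rw [← mul_assoc, h, mul_assoc]

lemma lintegral_natCast_poissonMeasure (r : NNReal) :
    ∫⁻ n, (n : ℝ≥0∞) ∂(poissonMeasure r) = r := by
  simpa using lintegral_natCast_mul_poissonMeasure r fun _ => 1

lemma lintegral_natCast_mul_self_poissonMeasure (r : NNReal) :
    ∫⁻ n, (n : ℝ≥0∞) * n ∂(poissonMeasure r) = r * r + r := by
  rw [lintegral_natCast_mul_poissonMeasure r fun n => (n : ℝ≥0∞)]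
  simp only [Nat.cast_add, Nat.cast_one]
  rw [lintegral_add_right _ measurable_const, lintegral_natCast_poissonMeasure]
  simp [mul_add]

/-! ### First and second moment formulas for Poisson processes -/

lemma toENNReal_encard_eq_tsum (s : Set ℕ) :
    (s.encard : ℝ≥0∞) = ∑' i, s.indicator 1 i := by
  rw [← ENNReal.tsum_set_one, ← tsum_subtype]
  rfl

lemma toENNReal_pointCount {Ω E : Type*} (X : ℕ → Ω → E) (B : Set E) (ω : Ω) :
    (pointCount X B ω : ℝ≥0∞) = ∑' i, B.indicator 1 (X i ω) := by
  rw [pointCount, toENNReal_encard_eq_tsum]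
  rfl

lemma toENNReal_pointCount_union {Ω E : Type*} {X : ℕ → Ω → E} {s t : Set E}
    (hst : Disjoint s t) (ω : Ω) :
    (pointCount X (s ∪ t) ω : ℝ≥0∞) = pointCount X s ω + pointCount X t ω := by
  simp only [toENNReal_pointCount, Set.indicator_union_of_disjoint hst, ENNReal.tsum_add]

variable {Ω : Type*} [MeasurableSpace Ω] {P : Measure Ω}

section PoissonProcess

variable {E : Type*} [MeasurableSpace E] {ν : Measure E} {X : ℕ → Ω → E}

namespace IsPoissonProcess

lemma measurable_pointCount (hX : IsPoissonProcess ν P X) {B : Set E} (hB : MeasurableSet B) :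
    Measurable fun ω => (pointCount X B ω : ℝ≥0∞) := by
  simp only [toENNReal_pointCount]
  exact Measurable.tsum fun i => (measurable_one.indicator hB).comp (hX.measurable i)

lemma lintegral_comp_pointCount (hX : IsPoissonProcess ν P X) {B : Set E} (hB : MeasurableSet B)
    (hνB : ν B ≠ ∞) (f : ℕ∞ → ℝ≥0∞) :
    ∫⁻ ω, f (pointCount X B ω) ∂P = ∫⁻ n : ℕ, f n ∂(poissonMeasure (ν B).toNNReal) := by
  have hlaw := hX.law_count B hB hνB
  have hae : AEMeasurable (pointCount X B) P :=
    AEMeasurable.of_map_ne_zero (by rw [hlaw]; exact IsProbabilityMeasure.ne_zero _)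
  have hf : Measurable f := .of_discrete
  rw [← lintegral_map' hf.aemeasurable hae, hlaw, lintegral_map hf .of_discrete]

lemma lintegral_pointCount (hX : IsPoissonProcess ν P X) {B : Set E} (hB : MeasurableSet B)
    (hνB : ν B ≠ ∞) : ∫⁻ ω, (pointCount X B ω : ℝ≥0∞) ∂P = ν B := by
  rw [hX.lintegral_comp_pointCount hB hνB fun n => (n : ℝ≥0∞)]
  simp [lintegral_natCast_poissonMeasure, ENNReal.coe_toNNReal hνB]

lemma lintegral_pointCount_mul_self (hX : IsPoissonProcess ν P X) {B : Set E}
    (hB : MeasurableSet B) (hνB : ν B ≠ ∞) :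
    ∫⁻ ω, (pointCount X B ω : ℝ≥0∞) * pointCount X B ω ∂P = ν B * ν B + ν B := by
  rw [hX.lintegral_comp_pointCount hB hνB fun n => (n : ℝ≥0∞) * n]
  simp [lintegral_natCast_mul_self_poissonMeasure, ENNReal.coe_toNNReal hνB]

lemma lintegral_pointCount_mul_of_disjoint (hX : IsPoissonProcess ν P X) {s t : Set E}
    (hs : MeasurableSet s) (ht : MeasurableSet t) (hνs : ν s ≠ ∞) (hνt : ν t ≠ ∞)
    (hst : Disjoint s t) :
    ∫⁻ ω, (pointCount X s ω : ℝ≥0∞) * pointCount X t ω ∂P = ν s * ν t := by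
  have hind := (hX.indep_count 2 ![s, t] (by simp [Fin.forall_fin_two, hs, ht]) (by
    intro j l hjl
    fin_cases j <;> fin_cases l <;> simp_all [disjoint_comm])).indepFun
      (show (0 : Fin 2) ≠ 1 by decide)
  have hind' : IndepFun (fun ω => (pointCount X s ω : ℝ≥0∞))
      (fun ω => (pointCount X t ω : ℝ≥0∞)) P :=
    hind.comp (φ := fun n : ℕ∞ => (n : ℝ≥0∞)) (ψ := fun n : ℕ∞ => (n : ℝ≥0∞))
      .of_discrete .of_discrete
  have := lintegral_mul_eq_lintegral_mul_lintegral_of_indepFun (hX.measurable_pointCount hs)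
    (hX.measurable_pointCount ht) hind'
  rw [hX.lintegral_pointCount hs hνs, hX.lintegral_pointCount ht hνt] at this
  exact this

/-- The covariance of the counts in `s` and `t` is `ν (s ∩ t)`. -/
lemma lintegral_pointCount_mul (hX : IsPoissonProcess ν P X) {s t : Set E}
    (hs : MeasurableSet s) (ht : MeasurableSet t) (hνs : ν s ≠ ∞) (hνt : ν t ≠ ∞) :
    ∫⁻ ω, (pointCount X s ω : ℝ≥0∞) * pointCount X t ω ∂P = ν s * ν t + ν (s ∩ t) := by
  have hst := hs.inter ht
  have hsd := hs.diff ht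
  have htd := ht.diff hs
  have hνst : ν (s ∩ t) ≠ ∞ := measure_ne_top_of_subset Set.inter_subset_left hνs
  have hνsd : ν (s \ t) ≠ ∞ := measure_ne_top_of_subset Set.sdiff_subset hνs
  have hνtd : ν (t \ s) ≠ ∞ := measure_ne_top_of_subset Set.sdiff_subset hνt
  have d₁ : Disjoint (s ∩ t) (s \ t) := Set.disjoint_sdiff_inter.symm
  have d₂ : Disjoint (s ∩ t) (t \ s) := by
    rw [Set.inter_comm]; exact Set.disjoint_sdiff_inter.symm
  have d₃ : Disjoint (s \ t) (t \ s) := disjoint_sdiff_sdiff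
  have es : s = (s ∩ t) ∪ (s \ t) := (Set.inter_union_sdiff s t).symm
  have et : t = (s ∩ t) ∪ (t \ s) := by rw [Set.inter_comm]; exact (Set.inter_union_sdiff t s).symm
  have hexp : ∀ ω, (pointCount X s ω : ℝ≥0∞) * pointCount X t ω =
      pointCount X (s ∩ t) ω * pointCount X (s ∩ t) ω
      + pointCount X (s ∩ t) ω * pointCount X (t \ s) ω
      + pointCount X (s ∩ t) ω * pointCount X (s \ t) ω
      + pointCount X (s \ t) ω * pointCount X (t \ s) ω := by
    intro ω
    have h₁ := toENNReal_pointCount_union (X := X) d₁ ω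
    have h₂ := toENNReal_pointCount_union (X := X) d₂ ω
    rw [← es] at h₁
    rw [← et] at h₂
    rw [h₁, h₂]
    ring
  have m₁ := hX.measurable_pointCount hst
  have m₂ := hX.measurable_pointCount hsd
  have m₃ := hX.measurable_pointCount htd
  simp only [hexp]
  rw [lintegral_add_left (by fun_prop), lintegral_add_left (by fun_prop),
    lintegral_add_left (by fun_prop), hX.lintegral_pointCount_mul_self hst hνst,
    hX.lintegral_pointCount_mul_of_disjoint hst htd hνst hνtd d₂,
    hX.lintegral_pointCount_mul_of_disjoint hst hsd hνst hνsd d₁,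
    hX.lintegral_pointCount_mul_of_disjoint hsd htd hνsd hνtd d₃]
  have a₁ : ν s = ν (s ∩ t) + ν (s \ t) := (measure_inter_add_sdiff s ht).symm
  have a₂ : ν t = ν (s ∩ t) + ν (t \ s) := by
    rw [Set.inter_comm]; exact (measure_inter_add_sdiff t hs).symm
  rw [a₁, a₂]
  ring

/-- Campbell's formula: the intensity measure is the sum of the laws of the points. -/
lemma sum_map_eq [SigmaFinite ν] (hX : IsPoissonProcess ν P X) :
    Measure.sum (fun i => P.map (X i)) = ν := by
  have hfin : ∀ B, MeasurableSet B → ν B ≠ ∞ → Measure.sum (fun i => P.map (X i)) B = ν B := by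
    intro B hB hνB
    rw [← hX.lintegral_pointCount hB hνB, Measure.sum_apply _ hB]
    simp only [toENNReal_pointCount]
    have hm : ∀ i, Measurable fun ω => B.indicator (1 : E → ℝ≥0∞) (X i ω) := fun i =>
      (measurable_one.indicator hB).comp (hX.measurable i)
    rw [lintegral_tsum fun i => (hm i).aemeasurable]
    refine tsum_congr fun i => ?_
    rw [Measure.map_apply (hX.measurable i) hB, ← lintegral_indicator_one (hX.measurable i hB)]
    rfl
  ext B hB
  have hU : B = ⋃ n, B ∩ spanningSets ν n := by
    rw [← Set.inter_iUnion, iUnion_spanningSets, Set.inter_univ]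
  have hmono : Monotone fun n => B ∩ spanningSets ν n := fun _ _ h =>
    Set.inter_subset_inter_right B (monotone_spanningSets ν h)
  rw [hU, hmono.measure_iUnion, hmono.measure_iUnion]
  refine iSup_congr fun n => hfin _ (hB.inter (measurableSet_spanningSets ν n)) ?_
  exact measure_ne_top_of_subset Set.inter_subset_right (measure_spanningSets_lt_top ν n).ne

lemma tsum_lintegral_comp [SigmaFinite ν] (hX : IsPoissonProcess ν P X) {g : E → ℝ≥0∞}
    (hg : Measurable g) : ∑' i, ∫⁻ ω, g (X i ω) ∂P = ∫⁻ x, g x ∂ν := by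
  conv_rhs => rw [← hX.sum_map_eq, lintegral_sum_measure]
  exact tsum_congr fun i => (lintegral_map hg (hX.measurable i)).symm

lemma ae_forall_of_ae [SigmaFinite ν] (hX : IsPoissonProcess ν P X) {p : E → Prop}
    (hp : ∀ᵐ x ∂ν, p x) : ∀ᵐ ω ∂P, ∀ i, p (X i ω) := by
  rw [← hX.sum_map_eq, Measure.ae_sum_iff] at hp
  exact ae_all_iff.2 fun i => ae_of_ae_map (hX.measurable i).aemeasurable (hp i)

/-- The second factorial moment measure of a Poisson process is the product measure of its
intensity: pairs of distinct points behave as if they were independent. -/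
lemma sum_map_prod_eq [SigmaFinite ν] (hX : IsPoissonProcess ν P X) :
    Measure.sum (fun i => Measure.sum fun j =>
      if j = i then 0 else P.map (fun ω => (X i ω, X j ω))) = ν.prod ν := by
  have hgen : MeasurableSpace.generateFrom {s : Set E | MeasurableSet s ∧ ν s ≠ ∞} = ‹_› := by
    refine le_antisymm (MeasurableSpace.generateFrom_le fun s hs => hs.1) fun s hs => ?_
    rw [← Set.inter_univ s, ← iUnion_spanningSets ν, Set.inter_iUnion]
    refine MeasurableSet.iUnion fun n => MeasurableSpace.measurableSet_generateFrom
      ⟨hs.inter (measurableSet_spanningSets ν n), ?_⟩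
    exact measure_ne_top_of_subset Set.inter_subset_right (measure_spanningSets_lt_top ν n).ne
  have hpi : IsPiSystem {s : Set E | MeasurableSet s ∧ ν s ≠ ∞} := fun s hs t ht _ =>
    ⟨hs.1.inter ht.1, measure_ne_top_of_subset Set.inter_subset_left hs.2⟩
  have hspan : ν.FiniteSpanningSetsIn {s : Set E | MeasurableSet s ∧ ν s ≠ ∞} :=
    { set := spanningSets ν
      set_mem := fun n =>
        ⟨measurableSet_spanningSets ν n, (measure_spanningSets_lt_top ν n).ne⟩
      finite := measure_spanningSets_lt_top ν
      spanning := iUnion_spanningSets ν }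
  refine (Measure.prod_eq_generateFrom hgen hgen hpi hpi hspan hspan ?_).symm
  rintro s ⟨hs, hνs⟩ t ⟨ht, hνt⟩
  have hνst : ν (s ∩ t) ≠ ∞ := measure_ne_top_of_subset Set.inter_subset_left hνs
  have hmeas : ∀ i j, MeasurableSet {ω | X i ω ∈ s ∧ X j ω ∈ t} := fun i j =>
    (hX.measurable i hs).inter (hX.measurable j ht)
  -- All pairs of points, including the diagonal ones.
  have hall : ∑' i, ∑' j, P {ω | X i ω ∈ s ∧ X j ω ∈ t} = ν s * ν t + ν (s ∩ t) := by
    rw [← hX.lintegral_pointCount_mul hs ht hνs hνt]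
    simp only [toENNReal_pointCount, ← ENNReal.tsum_mul_left, ← ENNReal.tsum_mul_right]
    have hm : ∀ i j, Measurable fun ω =>
        s.indicator (1 : E → ℝ≥0∞) (X i ω) * t.indicator (1 : E → ℝ≥0∞) (X j ω) := fun i j =>
      ((measurable_one.indicator hs).comp (hX.measurable i)).mul
        ((measurable_one.indicator ht).comp (hX.measurable j))
    rw [ENNReal.tsum_comm,
      lintegral_tsum fun j => (Measurable.tsum fun i => hm i j).aemeasurable]
    refine tsum_congr fun j => ?_
    rw [lintegral_tsum fun i => (hm i j).aemeasurable]
    refine tsum_congr fun i => ?_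
    rw [← lintegral_indicator_one (hmeas i j)]
    refine lintegral_congr fun ω => ?_
    by_cases h₁ : X i ω ∈ s <;> by_cases h₂ : X j ω ∈ t <;> simp [h₁, h₂]
  have hdiag : ∑' i, P {ω | X i ω ∈ s ∧ X i ω ∈ t} = ν (s ∩ t) := by
    conv_rhs => rw [← hX.sum_map_eq, Measure.sum_apply _ (hs.inter ht)]
    exact tsum_congr fun i => (Measure.map_apply (hX.measurable i) (hs.inter ht)).symm
  have hsplit : ∀ i, ∑' j, P {ω | X i ω ∈ s ∧ X j ω ∈ t} =
      P {ω | X i ω ∈ s ∧ X i ω ∈ t} +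
        ∑' j, if j = i then 0 else P {ω | X i ω ∈ s ∧ X j ω ∈ t} := fun i =>
    (ENNReal.tsum_eq_add_tsum_ite i).trans
      (congrArg _ (tsum_congr fun j => by split_ifs <;> rfl))
  simp only [hsplit] at hall
  rw [ENNReal.tsum_add, hdiag, add_comm] at hall
  rw [← (ENNReal.add_left_inj hνst).1 hall, Measure.sum_apply _ (hs.prod ht)]
  refine tsum_congr fun i => ?_
  rw [Measure.sum_apply _ (hs.prod ht)]
  refine tsum_congr fun j => ?_
  split_ifs with h
  · simp
  · rw [Measure.map_apply ((hX.measurable i).prodMk (hX.measurable j)) (hs.prod ht)]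
    rfl

lemma tsum_lintegral_comp_mul [SigmaFinite ν] (hX : IsPoissonProcess ν P X) {g : E → ℝ≥0∞}
    (hg : Measurable g) :
    ∑' i, ∑' j, (if j = i then 0 else ∫⁻ ω, g (X i ω) * g (X j ω) ∂P) =
      (∫⁻ x, g x ∂ν) * ∫⁻ x, g x ∂ν := by
  have hG : Measurable fun p : E × E => g p.1 * g p.2 := by fun_prop
  rw [← lintegral_prod_mul hg.aemeasurable hg.aemeasurable, ← hX.sum_map_prod_eq,
    lintegral_sum_measure]
  refine tsum_congr fun i => ?_
  rw [lintegral_sum_measure]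
  refine tsum_congr fun j => ?_
  split_ifs with h
  · simp
  · rw [lintegral_map hG ((hX.measurable i).prodMk (hX.measurable j))]

end IsPoissonProcess

end PoissonProcess

/-! ### Beta integrals and ratios of Gamma values -/

lemma lintegral_Ioo_rpow_mul_rpow {a b : ℝ} (ha : 0 < a) (hb : 0 < b) :
    ∫⁻ x in Set.Ioo (0 : ℝ) 1, ENNReal.ofReal (x ^ (a - 1) * (1 - x) ^ (b - 1)) =
      ENNReal.ofReal (beta a b) := by
  have hβ := beta_pos ha hb
  have h := lintegral_betaPDF_eq_one ha hb
  rw [lintegral_betaPDF] at h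
  have e : ∀ x : ℝ, ENNReal.ofReal (1 / beta a b * x ^ (a - 1) * (1 - x) ^ (b - 1)) =
      ENNReal.ofReal (1 / beta a b) * ENNReal.ofReal (x ^ (a - 1) * (1 - x) ^ (b - 1)) := by
    intro x
    rw [← ENNReal.ofReal_mul (by positivity), mul_assoc]
  simp only [e] at h
  rw [lintegral_const_mul _ (by fun_prop)] at h
  rw [one_div, ENNReal.ofReal_inv_of_pos hβ] at h
  have h0 : ENNReal.ofReal (beta a b) ≠ 0 := by simpa using hβ
  calc _ = ENNReal.ofReal (beta a b) * ((ENNReal.ofReal (beta a b))⁻¹ * _) := by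
        rw [← mul_assoc, ENNReal.mul_inv_cancel h0 ENNReal.ofReal_ne_top, one_mul]
    _ = _ := by rw [h, mul_one]

/-- The sum telescopes. At `c = 0` the term `Γ(c)` is the junk value `0`, and the formula survives
because Lean's `1 / Γ(0) = 0` is also the value at `0` of the entire function `1 / Γ`. -/
lemma sum_Gamma_div_Gamma {c σ : ℝ} (hc : -σ < c) (hσ1 : σ < 1) (N : ℕ) :
    σ * ∑ k ∈ Finset.range N, Real.Gamma (c + σ + k) / Real.Gamma (c + 1 + k) =
      Real.Gamma (c + σ + N) / Real.Gamma (c + N) - Real.Gamma (c + σ) / Real.Gamma c := by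
  induction N with
  | zero => simp
  | succ N ih =>
    have h₀ : (0 : ℝ) ≤ N := N.cast_nonneg
    rw [Finset.sum_range_succ, mul_add, ih]
    have e₁ : c + σ + ((N + 1 : ℕ) : ℝ) = (c + σ + N) + 1 := by push_cast; ring
    have e₂ : c + ((N + 1 : ℕ) : ℝ) = (c + N) + 1 := by push_cast; ring
    have e₃ : c + 1 + N = (c + N) + 1 := by ring
    have h₁ : c + σ + N ≠ 0 := by linarith
    rw [e₁, e₂, e₃, Real.Gamma_add_one h₁]
    by_cases h₂ : c + N = 0
    · have : c + σ + N = σ := by linarith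
      simp only [h₂, this, Real.Gamma_zero, div_zero, zero_add, Real.Gamma_one, div_one]
      ring
    · have h₃ : Real.Gamma (c + N) ≠ 0 := by
        refine Real.Gamma_ne_zero fun m hm => ?_
        rcases Nat.eq_zero_or_pos m with rfl | hm'
        · simp at hm; exact h₂ hm
        · have : (1 : ℝ) ≤ m := by exact_mod_cast hm'
          linarith
      rw [Real.Gamma_add_one h₂]
      field_simp
      ring

/-- The upper half of Wendel's inequality, from the log-convexity of `Γ`. -/
lemma Gamma_add_le_rpow_mul_Gamma {x s : ℝ} (hx : 0 < x) (hs0 : 0 < s) (hs1 : s < 1) :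
    Real.Gamma (x + s) ≤ x ^ s * Real.Gamma x := by
  have h := Real.Gamma_mul_add_mul_le_rpow_Gamma_mul_rpow_Gamma hx (by linarith : 0 < x + 1)
    (by linarith : 0 < 1 - s) hs0 (by ring)
  have hG := Real.Gamma_pos_of_pos hx
  rw [Real.Gamma_add_one hx.ne', Real.mul_rpow hx.le hG.le] at h
  have e : (1 - s) * x + s * (x + 1) = x + s := by ring
  rw [e] at h
  refine h.trans (le_of_eq ?_)
  rw [mul_left_comm, ← Real.rpow_add hG]
  simp

lemma tendsto_Gamma_add_div {s : ℝ} (hs0 : 0 < s) (hs1 : s < 1) :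
    Tendsto (fun x : ℝ => Real.Gamma (x + s) / Real.Gamma x / x ^ s) atTop (𝓝 1) := by
  have hlow : Tendsto (fun x : ℝ => (x / (x + s)) ^ (1 - s)) atTop (𝓝 1) := by
    have h1 : Tendsto (fun x : ℝ => x / (x + s)) atTop (𝓝 1) := by
      have : Tendsto (fun x : ℝ => 1 - s / (x + s)) atTop (𝓝 (1 - 0)) :=
        tendsto_const_nhds.sub (tendsto_const_nhds.div_atTop
          (tendsto_atTop_add_const_right _ _ tendsto_id))
      rw [sub_zero] at this
      refine this.congr' ?_
      filter_upwards [eventually_gt_atTop 0] with x hx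
      field_simp
      ring
    simpa using h1.rpow_const (p := 1 - s) (Or.inl one_ne_zero)
  refine tendsto_of_tendsto_of_tendsto_of_le_of_le' hlow tendsto_const_nhds ?_ ?_
  · filter_upwards [eventually_gt_atTop 0] with x hx
    have hxs : 0 < x + s := by linarith
    have hG := Real.Gamma_pos_of_pos hx
    have h := Gamma_add_le_rpow_mul_Gamma hxs (by linarith : 0 < 1 - s) (by linarith)
    rw [show x + s + (1 - s) = x + 1 by ring, Real.Gamma_add_one hx.ne'] at h
    rw [Real.div_rpow hx.le hxs.le, div_div, div_le_div_iff₀ (by positivity) (by positivity)]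
    calc x ^ (1 - s) * (Real.Gamma x * x ^ s)
        = (x ^ (1 - s) * x ^ s) * Real.Gamma x := by ring
      _ = x * Real.Gamma x := by rw [← Real.rpow_add hx]; simp
      _ ≤ _ := by rw [mul_comm (Real.Gamma _)]; exact h
  · filter_upwards [eventually_gt_atTop 0] with x hx
    have hG := Real.Gamma_pos_of_pos hx
    rw [div_div, div_le_one (by positivity), mul_comm]
    exact Gamma_add_le_rpow_mul_Gamma hx hs0 hs1

lemma tendsto_Gamma_nat_ratio (c : ℝ) {σ : ℝ} (hσ0 : 0 < σ) (hσ1 : σ < 1) :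
    Tendsto (fun N : ℕ => Real.Gamma (c + σ + N) / Real.Gamma (c + N) / (N : ℝ) ^ σ)
      atTop (𝓝 1) := by
  have hN : Tendsto (fun N : ℕ => c + (N : ℝ)) atTop atTop :=
    tendsto_atTop_add_const_left _ _ tendsto_natCast_atTop_atTop
  have h1 := (tendsto_Gamma_add_div hσ0 hσ1).comp hN
  have h2 : Tendsto (fun N : ℕ => ((c + (N : ℝ)) / N) ^ σ) atTop (𝓝 1) := by
    have : Tendsto (fun N : ℕ => (c + (N : ℝ)) / N) atTop (𝓝 1) := by
      have : Tendsto (fun N : ℕ => c / (N : ℝ) + 1) atTop (𝓝 (0 + 1)) :=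
        (tendsto_const_nhds.div_atTop tendsto_natCast_atTop_atTop).add_const 1
      rw [zero_add] at this
      refine this.congr' ?_
      filter_upwards [eventually_gt_atTop 0] with N hN
      have : (N : ℝ) ≠ 0 := by positivity
      field_simp
    simpa using this.rpow_const (p := σ) (Or.inl one_ne_zero)
  have h3 := h1.mul h2
  rw [one_mul] at h3
  refine h3.congr' ?_
  filter_upwards [hN.eventually_gt_atTop 0, eventually_gt_atTop 0] with N h4 h5
  have h5' : (0 : ℝ) < N := by exact_mod_cast h5
  simp only [Function.comp]
  rw [Real.div_rpow h4.le h5'.le, show c + (N : ℝ) + σ = c + σ + N by ring]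
  field_simp

/-! ### The expected number of non-zero columns -/

/-- The integral `∫ (1 - (1 - x) ^ N) ν(dx)` of the probability of hitting an atom of weight `x` in
`N` draws against the Lévy measure, in closed form. -/
noncomputable def meanColumns (c σ α : ℝ) (N : ℕ) : ℝ :=
  α * (Real.Gamma (1 + c) / Real.Gamma (c + σ)) *
    ∑ k ∈ Finset.range N, Real.Gamma (c + σ + k) / Real.Gamma (c + 1 + k)

lemma meanColumns_nonneg {c σ α : ℝ} (hσ1 : σ < 1) (hc : -σ < c) (hα : 0 < α) (N : ℕ) :
    0 ≤ meanColumns c σ α N := by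
  have h1 := Real.Gamma_pos_of_pos (by linarith : 0 < 1 + c)
  have h2 := Real.Gamma_pos_of_pos (by linarith : 0 < c + σ)
  refine mul_nonneg (by positivity) (Finset.sum_nonneg fun k _ => ?_)
  have h₀ : (0 : ℝ) ≤ k := k.cast_nonneg
  exact div_nonneg (Real.Gamma_pos_of_pos (by linarith)).le
    (Real.Gamma_pos_of_pos (by linarith)).le

lemma growthConst_pos {c σ α : ℝ} (hσ0 : 0 < σ) (hσ1 : σ < 1) (hc : -σ < c) (hα : 0 < α) :
    0 < growthConst c σ α := by
  have h1 := Real.Gamma_pos_of_pos (by linarith : 0 < c + 1)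
  have h2 := Real.Gamma_pos_of_pos (by linarith : 0 < c + σ)
  unfold growthConst
  positivity

lemma tendsto_meanColumns_div {c σ : ℝ} (α : ℝ) (hσ0 : 0 < σ) (hσ1 : σ < 1) (hc : -σ < c) :
    Tendsto (fun N : ℕ => meanColumns c σ α N / (N : ℝ) ^ σ) atTop (𝓝 (growthConst c σ α)) := by
  have hpow : Tendsto (fun N : ℕ => (N : ℝ) ^ σ) atTop atTop :=
    (tendsto_rpow_atTop hσ0).comp tendsto_natCast_atTop_atTop
  have h := (((tendsto_Gamma_nat_ratio c hσ0 hσ1).sub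
    ((tendsto_const_nhds (x := Real.Gamma (c + σ) / Real.Gamma c)).div_atTop hpow)).const_mul
    (growthConst c σ α))
  rw [sub_zero, mul_one] at h
  refine h.congr fun N => ?_
  rw [← sub_div, ← sum_Gamma_div_Gamma hc hσ1, growthConst, meanColumns, add_comm c 1]
  field_simp

/-- After pulling out one factor `x`, the geometric sum turns the integral into a sum of Beta
integrals. -/
lemma lintegral_one_sub_pow_stableBetaLevy {c σ α : ℝ} (hσ1 : σ < 1) (hc : -σ < c)
    (hα : 0 < α) (N : ℕ) :
    ∫⁻ x, (1 - ENNReal.ofReal (1 - x) ^ N) ∂(stableBetaLevy c σ α) =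
      ENNReal.ofReal (meanColumns c σ α N) := by
  have h1 := Real.Gamma_pos_of_pos (by linarith : 0 < 1 + c)
  have h2 := Real.Gamma_pos_of_pos (by linarith : 0 < c + σ)
  have h3 := Real.Gamma_pos_of_pos (by linarith : 0 < 1 - σ)
  set D := α * (Real.Gamma (1 + c) / (Real.Gamma (1 - σ) * Real.Gamma (c + σ))) with hD
  have hD0 : 0 ≤ D := by positivity
  rw [stableBetaLevy, lintegral_withDensity_eq_lintegral_mul _ (by fun_prop) (by fun_prop),
    setLIntegral_congr Ioo_ae_eq_Ioc.symm]
  have key : ∀ x ∈ Set.Ioo (0 : ℝ) 1,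
      ((fun x => ENNReal.ofReal (D * x ^ (-σ - 1) * (1 - x) ^ (c + σ - 1))) *
        fun x => 1 - ENNReal.ofReal (1 - x) ^ N) x =
      ∑ k ∈ Finset.range N, ENNReal.ofReal D *
        ENNReal.ofReal (x ^ ((1 - σ) - 1) * (1 - x) ^ ((c + σ + k) - 1)) := by
    rintro x ⟨hx0, hx1⟩
    have hy : 0 < 1 - x := by linarith
    simp only [Pi.mul_apply]
    rw [← ENNReal.ofReal_pow hy.le, ← ENNReal.ofReal_one, ← ENNReal.ofReal_sub _ (by positivity),
      ← ENNReal.ofReal_mul (by positivity)]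
    simp only [← ENNReal.ofReal_mul hD0]
    rw [← ENNReal.ofReal_sum_of_nonneg fun k _ => by positivity]
    congr 1
    have hgeom := mul_neg_geom_sum (1 - x) N
    rw [sub_sub_cancel] at hgeom
    rw [← hgeom, Finset.mul_sum, Finset.mul_sum]
    refine Finset.sum_congr rfl fun k _ => ?_
    rw [show (1 - σ) - 1 = (-σ - 1) + 1 by ring, Real.rpow_add_one hx0.ne',
      show (c + σ + k) - 1 = (c + σ - 1) + k by ring, Real.rpow_add_natCast hy.ne']
    ring
  rw [setLIntegral_congr_fun measurableSet_Ioo key,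
    lintegral_finsetSum _ fun k _ => by fun_prop, meanColumns, Finset.mul_sum,
    ENNReal.ofReal_sum_of_nonneg]
  · refine Finset.sum_congr rfl fun k _ => ?_
    have h₀ : (0 : ℝ) ≤ k := k.cast_nonneg
    rw [lintegral_const_mul _ (by fun_prop),
      lintegral_Ioo_rpow_mul_rpow (by linarith) (by linarith), ← ENNReal.ofReal_mul hD0, beta,
      show 1 - σ + (c + σ + k) = c + 1 + k by ring, hD]
    congr 1
    field_simp
  · intro k _
    have h₀ : (0 : ℝ) ≤ k := k.cast_nonneg
    have h4 := Real.Gamma_pos_of_pos (by linarith : 0 < c + σ + k)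
    have h5 := Real.Gamma_pos_of_pos (by linarith : 0 < c + 1 + k)
    positivity

instance sigmaFinite_stableBetaLevy (c σ α : ℝ) : SigmaFinite (stableBetaLevy c σ α) :=
  SigmaFinite.withDensity_ofReal _

lemma ae_mem_Ioc_stableBetaLevy (c σ α : ℝ) :
    ∀ᵐ x ∂(stableBetaLevy c σ α), x ∈ Set.Ioc (0 : ℝ) 1 :=
  (withDensity_absolutelyContinuous _ _).ae_le (ae_restrict_mem measurableSet_Ioc)

/-! ### Moments of the number of non-zero columns -/

/-- The probability that at least one of `N` independent events of probability `x` occurs.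
Only `0 ≤ x ≤ 1` matters; values outside this range are truncated. -/
noncomputable def hitProb (N : ℕ) (x : ℝ) : ℝ≥0∞ := 1 - ENNReal.ofReal (1 - x) ^ N

@[fun_prop]
lemma measurable_hitProb (N : ℕ) : Measurable (hitProb N) := by
  unfold hitProb
  fun_prop

/-- Inclusion–exclusion for a mixture of pairs of independent events. -/
lemma measure_compl_inter_compl_of_eq_lintegral [IsProbabilityMeasure P] {F G : Set Ω}
    (hF : MeasurableSet F) (hG : MeasurableSet G) {a b : Ω → ℝ≥0∞}
    (ha : Measurable a) (hb : Measurable b) (ha1 : ∀ᵐ ω ∂P, a ω ≤ 1) (hb1 : ∀ᵐ ω ∂P, b ω ≤ 1)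
    (hPF : P F = ∫⁻ ω, a ω ∂P) (hPG : P G = ∫⁻ ω, b ω ∂P)
    (hPFG : P (F ∩ G) = ∫⁻ ω, a ω * b ω ∂P) :
    P (Fᶜ ∩ Gᶜ) = ∫⁻ ω, (1 - a ω) * (1 - b ω) ∂P := by
  have h1 : P Gᶜ = ∫⁻ ω, (1 - b ω) ∂P := by
    refine (ENNReal.add_left_inj (measure_ne_top P G)).1 ?_
    rw [add_comm, measure_add_measure_compl hG, hPG, ← lintegral_add_right _ hb, ← lintegral_one]
    exact lintegral_congr_ae (hb1.mono fun ω h => (tsub_add_cancel_of_le h).symm)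
  have h2 : P (F ∩ Gᶜ) = ∫⁻ ω, a ω * (1 - b ω) ∂P := by
    refine (ENNReal.add_left_inj (measure_ne_top P (F ∩ G))).1 ?_
    rw [add_comm, ← Set.sdiff_eq, measure_inter_add_sdiff F hG, hPF, hPFG,
      ← lintegral_add_right _ (by fun_prop)]
    refine lintegral_congr_ae (hb1.mono fun ω h => ?_)
    simp only [← mul_add, tsub_add_cancel_of_le h, mul_one]
  refine (ENNReal.add_left_inj (measure_ne_top P (F ∩ Gᶜ))).1 ?_
  have h3 : P (Fᶜ ∩ Gᶜ) + P (F ∩ Gᶜ) = P Gᶜ := by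
    rw [add_comm, Set.inter_comm F, Set.inter_comm Fᶜ, ← Set.sdiff_eq,
      measure_inter_add_sdiff _ hF]
  rw [h3, h1, h2, ← lintegral_add_right _ (by fun_prop)]
  refine lintegral_congr_ae (ha1.mono fun ω h => ?_)
  simp only [← add_mul, tsub_add_cancel_of_le h, one_mul]

section CliqueMatrix

variable {𝒱 : Type*} [MeasurableSpace 𝒱] {w : ℕ → Ω → ℝ} {θ : ℕ → Ω → 𝒱} {Z : ℕ → ℕ → Ω → Bool}

namespace IsCliqueMatrix

lemma measurableSet_mem_nonzeroColumns (hZ : IsCliqueMatrix P w θ Z) (N i : ℕ) :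
    MeasurableSet {ω | i ∈ nonzeroColumns Z N ω} := by
  have : {ω | i ∈ nonzeroColumns Z N ω} = ⋃ n, ⋃ _ : n < N, Z n i ⁻¹' {true} := by
    ext ω
    simp [nonzeroColumns]
  rw [this]
  exact .iUnion fun n => .iUnion fun _ => hZ.measurable n i (measurableSet_singleton _)

lemma measure_columns_eq_zero (hZ : IsCliqueMatrix P w θ Z) (N : ℕ) (I : Finset ℕ) :
    P {ω | ∀ i ∈ I, i ∉ nonzeroColumns Z N ω} =
      ∫⁻ ω, ∏ i ∈ I, ENNReal.ofReal (1 - w i ω) ^ N ∂P := by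
  have h := hZ.cond_law (Finset.range N ×ˢ I) (fun _ => false) Set.univ MeasurableSet.univ
  simp only [Set.mem_univ, true_and, Set.ofPred_true, Measure.restrict_univ, Bool.false_eq_true,
    if_false, Finset.prod_product_right, Finset.prod_const, Finset.card_range] at h
  rw [← h]
  congr 1
  ext ω
  simp only [nonzeroColumns, Set.mem_ofPred_eq, Finset.mem_product, Finset.mem_range, Prod.forall,
    not_exists, not_and, Bool.not_eq_true]
  exact ⟨fun h n i hni => h i hni.2 n hni.1, fun h i hi n hn => h n i ⟨hn, hi⟩⟩

lemma measurable_encard_nonzeroColumns (hZ : IsCliqueMatrix P w θ Z) (N : ℕ) :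
    Measurable fun ω => ((nonzeroColumns Z N ω).encard : ℝ≥0∞) := by
  simp only [toENNReal_encard_eq_tsum]
  exact Measurable.tsum fun i =>
    measurable_one.indicator (hZ.measurableSet_mem_nonzeroColumns N i)

variable [IsProbabilityMeasure P]

lemma measure_mem_mem_nonzeroColumns (hZ : IsCliqueMatrix P w θ Z) (hw : ∀ i, Measurable (w i))
    (hw0 : ∀ᵐ ω ∂P, ∀ i, 0 ≤ w i ω) (N : ℕ) {i j : ℕ} (hij : j ≠ i) :
    P {ω | i ∈ nonzeroColumns Z N ω ∧ j ∈ nonzeroColumns Z N ω} =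
      ∫⁻ ω, hitProb N (w i ω) * hitProb N (w j ω) ∂P := by
  have hle : ∀ i, ∀ᵐ ω ∂P, ENNReal.ofReal (1 - w i ω) ^ N ≤ 1 := fun i =>
    hw0.mono fun ω h => pow_le_one₀ zero_le (ENNReal.ofReal_le_one.2 (by linarith [h i]))
  have h1 : ∀ i, P {ω | i ∈ nonzeroColumns Z N ω}ᶜ = ∫⁻ ω, ENNReal.ofReal (1 - w i ω) ^ N ∂P :=
    fun i => by simpa [Set.compl_ofPred] using hZ.measure_columns_eq_zero N {i}
  have h2 : P ({ω | i ∈ nonzeroColumns Z N ω}ᶜ ∩ {ω | j ∈ nonzeroColumns Z N ω}ᶜ) =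
      ∫⁻ ω, ENNReal.ofReal (1 - w i ω) ^ N * ENNReal.ofReal (1 - w j ω) ^ N ∂P := by
    have := hZ.measure_columns_eq_zero N {i, j}
    simp only [Finset.prod_pair hij.symm, Finset.mem_insert, Finset.mem_singleton,
      forall_eq_or_imp, forall_eq] at this
    exact this
  have h3 := measure_compl_inter_compl_of_eq_lintegral
    (hZ.measurableSet_mem_nonzeroColumns N i).compl (hZ.measurableSet_mem_nonzeroColumns N j).compl
    (by fun_prop) (by fun_prop) (hle i) (hle j) (h1 i) (h1 j) h2
  rw [compl_compl, compl_compl] at h3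
  exact h3

lemma measure_mem_nonzeroColumns (hZ : IsCliqueMatrix P w θ Z) (hw : ∀ i, Measurable (w i))
    (hw0 : ∀ᵐ ω ∂P, ∀ i, 0 ≤ w i ω) (N i : ℕ) :
    P {ω | i ∈ nonzeroColumns Z N ω} = ∫⁻ ω, hitProb N (w i ω) ∂P := by
  have h1 : P {ω | i ∈ nonzeroColumns Z N ω}ᶜ = ∫⁻ ω, ENNReal.ofReal (1 - w i ω) ^ N ∂P := by
    simpa [Set.compl_ofPred] using hZ.measure_columns_eq_zero N {i}
  have hm : Measurable fun ω => hitProb N (w i ω) := by fun_prop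
  refine (ENNReal.add_left_inj (measure_ne_top P {ω | i ∈ nonzeroColumns Z N ω}ᶜ)).1 ?_
  rw [measure_add_measure_compl (hZ.measurableSet_mem_nonzeroColumns N i), h1,
    ← lintegral_add_left hm, ← lintegral_one]
  refine lintegral_congr_ae (hw0.mono fun ω h => ?_)
  exact (tsub_add_cancel_of_le
    (pow_le_one₀ zero_le (ENNReal.ofReal_le_one.2 (by linarith [h i])))).symm

variable {ν : Measure ℝ} [SigmaFinite ν]

lemma lintegral_encard_nonzeroColumns (hZ : IsCliqueMatrix P w θ Z) (hw : IsPoissonProcess ν P w)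
    (hν : ∀ᵐ x ∂ν, 0 ≤ x) (N : ℕ) :
    ∫⁻ ω, ((nonzeroColumns Z N ω).encard : ℝ≥0∞) ∂P = ∫⁻ x, hitProb N x ∂ν := by
  rw [← hw.tsum_lintegral_comp (measurable_hitProb N)]
  simp only [toENNReal_encard_eq_tsum]
  have hm : ∀ i, Measurable fun ω => (nonzeroColumns Z N ω).indicator (1 : ℕ → ℝ≥0∞) i := fun i =>
    measurable_one.indicator (hZ.measurableSet_mem_nonzeroColumns N i)
  rw [lintegral_tsum fun i => (hm i).aemeasurable]
  refine tsum_congr fun i => ?_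
  rw [← hZ.measure_mem_nonzeroColumns hw.measurable (hw.ae_forall_of_ae hν) N i,
    ← lintegral_indicator_one (hZ.measurableSet_mem_nonzeroColumns N i)]
  rfl

/-- Distinct points of a Poisson process contribute as if they were independent, so the second
moment is that of a Poisson variable. -/
lemma lintegral_encard_nonzeroColumns_mul_self (hZ : IsCliqueMatrix P w θ Z)
    (hw : IsPoissonProcess ν P w) (hν : ∀ᵐ x ∂ν, 0 ≤ x) (N : ℕ) :
    ∫⁻ ω, ((nonzeroColumns Z N ω).encard : ℝ≥0∞) * (nonzeroColumns Z N ω).encard ∂P =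
      ∫⁻ x, hitProb N x ∂ν + (∫⁻ x, hitProb N x ∂ν) * ∫⁻ x, hitProb N x ∂ν := by
  have hw0 := hw.ae_forall_of_ae hν
  have hm : ∀ i, Measurable fun ω => (nonzeroColumns Z N ω).indicator (1 : ℕ → ℝ≥0∞) i := fun i =>
    measurable_one.indicator (hZ.measurableSet_mem_nonzeroColumns N i)
  rw [← hw.tsum_lintegral_comp_mul (measurable_hitProb N),
    ← hw.tsum_lintegral_comp (measurable_hitProb N), ← ENNReal.tsum_add]
  simp only [toENNReal_encard_eq_tsum, ← ENNReal.tsum_mul_right]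
  have hm₂ : ∀ i j, Measurable fun ω => (nonzeroColumns Z N ω).indicator (1 : ℕ → ℝ≥0∞) i *
      (nonzeroColumns Z N ω).indicator (1 : ℕ → ℝ≥0∞) j := fun i j => (hm i).mul (hm j)
  simp only [← ENNReal.tsum_mul_left]
  rw [lintegral_tsum fun i => (Measurable.tsum (hm₂ i)).aemeasurable]
  refine tsum_congr fun i => ?_
  rw [lintegral_tsum fun j => (hm₂ i j).aemeasurable, ENNReal.tsum_eq_add_tsum_ite i]
  congr 1
  · rw [← hZ.measure_mem_nonzeroColumns hw.measurable hw0 N i,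
      ← lintegral_indicator_one (hZ.measurableSet_mem_nonzeroColumns N i)]
    refine lintegral_congr fun ω => ?_
    by_cases h : i ∈ nonzeroColumns Z N ω <;> simp [h]
  · refine tsum_congr fun j => ?_
    split_ifs with hij
    · rfl
    · rw [← hZ.measure_mem_mem_nonzeroColumns hw.measurable hw0 N hij,
        Set.ofPred_and, ← lintegral_indicator_one ((hZ.measurableSet_mem_nonzeroColumns N i).inter
          (hZ.measurableSet_mem_nonzeroColumns N j))]
      refine lintegral_congr fun ω => ?_
      by_cases h : i ∈ nonzeroColumns Z N ω <;> by_cases h' : j ∈ nonzeroColumns Z N ω <;>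
        simp [h, h', Set.indicator]

lemma ae_finite_nonzeroColumns (hZ : IsCliqueMatrix P w θ Z) (hw : IsPoissonProcess ν P w)
    (hν : ∀ᵐ x ∂ν, 0 ≤ x) {N : ℕ} (hfin : ∫⁻ x, hitProb N x ∂ν ≠ ∞) :
    ∀ᵐ ω ∂P, (nonzeroColumns Z N ω).Finite := by
  rw [← hZ.lintegral_encard_nonzeroColumns hw hν] at hfin
  filter_upwards [ae_lt_top (hZ.measurable_encard_nonzeroColumns N) hfin] with ω hω
  refine Set.encard_lt_top_iff.1 ?_
  exact_mod_cast hω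

/-- The variance of the number of non-zero columns is equal to its mean. -/
lemma lintegral_ncard_nonzeroColumns_sub_sq (hZ : IsCliqueMatrix P w θ Z)
    (hw : IsPoissonProcess ν P w) (hν : ∀ᵐ x ∂ν, 0 ≤ x) {N : ℕ} {m : ℝ} (hm0 : 0 ≤ m)
    (hm : ∫⁻ x, hitProb N x ∂ν = ENNReal.ofReal m) :
    ∫⁻ ω, ENNReal.ofReal (((nonzeroColumns Z N ω).ncard - m) ^ 2) ∂P = ENNReal.ofReal m := by
  have hK := hZ.measurable_encard_nonzeroColumns N
  have h1 := hZ.lintegral_encard_nonzeroColumns hw hν N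
  have h2 := hZ.lintegral_encard_nonzeroColumns_mul_self hw hν N
  rw [hm] at h1 h2
  -- Expand the square as `(K - m) ^ 2 + 2 m K = K ^ 2 + m ^ 2`, with non-negative terms only.
  have key : ∫⁻ ω, ENNReal.ofReal (((nonzeroColumns Z N ω).ncard - m) ^ 2) +
        ENNReal.ofReal (2 * m) * (nonzeroColumns Z N ω).encard ∂P =
      ∫⁻ ω, ((nonzeroColumns Z N ω).encard : ℝ≥0∞) * (nonzeroColumns Z N ω).encard +
        ENNReal.ofReal (m ^ 2) ∂P := by
    refine lintegral_congr_ae ?_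
    filter_upwards [hZ.ae_finite_nonzeroColumns hw hν (hm ▸ ENNReal.ofReal_ne_top)] with ω hω
    rw [← hω.cast_ncard_eq]
    simp only [ENat.toENNReal_coe]
    rw [← ENNReal.ofReal_natCast, ← ENNReal.ofReal_mul (by positivity),
      ← ENNReal.ofReal_mul (by positivity), ← ENNReal.ofReal_add (by positivity) (by positivity),
      ← ENNReal.ofReal_add (by positivity) (by positivity)]
    congr 1
    ring
  rw [lintegral_add_right _ (by fun_prop), lintegral_add_right _ measurable_const,
    lintegral_const_mul _ hK, h1, h2, lintegral_const, measure_univ, mul_one] at key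
  refine (ENNReal.add_left_inj (a := ENNReal.ofReal (2 * m) * ENNReal.ofReal m)
    (by finiteness)).1 ?_
  rw [key, ← ENNReal.ofReal_mul hm0, ← ENNReal.ofReal_mul (by positivity),
    ← ENNReal.ofReal_add (by positivity) (by positivity),
    ← ENNReal.ofReal_add (by positivity) (by positivity),
    ← ENNReal.ofReal_add (by positivity) (by positivity)]
  congr 1
  ring

end IsCliqueMatrix

end CliqueMatrix

/-! ### Interpolation between polynomially spaced indices -/

/-- Consecutive `p`-th powers have ratio tending to `1`, so monotonicity transfers a power law from
the `p`-th powers to all indices. -/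
lemma tendsto_div_rpow_of_monotone {f : ℕ → ℝ} (hf : Monotone f) (hf0 : ∀ N, 0 ≤ f N) {σ C : ℝ}
    (hσ : 0 < σ) {p : ℕ} (hp : p ≠ 0)
    (h : Tendsto (fun k : ℕ => f (k ^ p) / ((k ^ p : ℕ) : ℝ) ^ σ) atTop (𝓝 C)) :
    Tendsto (fun N : ℕ => f N / (N : ℝ) ^ σ) atTop (𝓝 C) := by
  -- the integer part of the `p`-th root of `N`
  set r : ℕ → ℕ := fun N => Nat.findGreatest (fun k => k ^ p ≤ N) N with hr
  have hr1 : ∀ N, r N ^ p ≤ N := fun N =>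
    Nat.findGreatest_spec (P := fun k => k ^ p ≤ N) (Nat.zero_le N) (by simp [hp])
  have hr2 : ∀ N, N ≤ (r N + 1) ^ p := by
    intro N
    by_cases hN : r N + 1 ≤ N
    · exact (not_le.1 (Nat.findGreatest_is_greatest (P := fun k => k ^ p ≤ N)
        (Nat.lt_succ_self _) hN)).le
    · exact (not_le.1 hN).le.trans (Nat.le_self_pow hp _)
  have hr3 : Tendsto r atTop atTop := by
    refine tendsto_atTop.2 fun b => ?_
    filter_upwards [eventually_ge_atTop (b ^ p)] with N hN
    exact Nat.le_findGreatest ((Nat.le_self_pow hp b).trans hN) hN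
  have hratio : Tendsto (fun k : ℕ => (((k + 1) ^ p : ℕ) : ℝ) ^ σ / ((k ^ p : ℕ) : ℝ) ^ σ)
      atTop (𝓝 1) := by
    have h1 : Tendsto (fun k : ℕ => ((k : ℝ) + 1) / k) atTop (𝓝 1) := by
      have : Tendsto (fun k : ℕ => 1 + 1 / (k : ℝ)) atTop (𝓝 (1 + 0)) :=
        tendsto_one_div_atTop_nhds_zero_nat.const_add 1
      rw [add_zero] at this
      refine this.congr' ?_
      filter_upwards [eventually_gt_atTop 0] with k hk
      have : (k : ℝ) ≠ 0 := by positivity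
      field_simp
    have h2 := (h1.pow p).rpow_const (p := σ) (Or.inl (by simp))
    rw [one_pow, Real.one_rpow] at h2
    refine h2.congr fun k => ?_
    rw [div_pow, Real.div_rpow (by positivity) (by positivity)]
    push_cast
    rfl
  have hup := ((h.comp (tendsto_add_atTop_nat 1)).mul hratio).comp hr3
  have hlo := (h.mul (hratio.inv₀ one_ne_zero)).comp hr3
  rw [mul_one] at hup
  rw [inv_one, mul_one] at hlo
  refine tendsto_of_tendsto_of_tendsto_of_le_of_le' hlo hup ?_ ?_
  · filter_upwards [hr3.eventually_gt_atTop 0] with N hN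
    have hrp : 0 < r N ^ p := pow_pos hN p
    have hN0 : 0 < N := hrp.trans_le (hr1 N)
    have e : ((r N ^ p : ℕ) : ℝ) ^ σ ≠ 0 := by positivity
    simp only [Function.comp]
    calc _ = f (r N ^ p) / (((r N + 1) ^ p : ℕ) : ℝ) ^ σ := by field_simp
      _ ≤ f N / (N : ℝ) ^ σ := by
        refine div_le_div₀ (hf0 N) (hf (hr1 N)) (by positivity) ?_
        exact Real.rpow_le_rpow (by positivity) (by exact_mod_cast hr2 N) hσ.le
  · filter_upwards [hr3.eventually_gt_atTop 0] with N hN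
    have hrp : 0 < r N ^ p := pow_pos hN p
    have e : (((r N + 1) ^ p : ℕ) : ℝ) ^ σ ≠ 0 := by positivity
    simp only [Function.comp]
    calc f N / (N : ℝ) ^ σ ≤ f ((r N + 1) ^ p) / ((r N ^ p : ℕ) : ℝ) ^ σ := by
          refine div_le_div₀ (hf0 _) (hf (hr2 N)) (by positivity) ?_
          exact Real.rpow_le_rpow (by positivity) (by exact_mod_cast hr1 N) hσ.le
      _ = _ := by field_simp

lemma isEquivalent_of_tendsto_div_rpow {u : ℕ → ℝ} {σ C : ℝ} (hC : C ≠ 0)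
    (h : Tendsto (fun N : ℕ => u N / (N : ℝ) ^ σ) atTop (𝓝 C)) :
    u ~[atTop] fun N : ℕ => C * (N : ℝ) ^ σ := by
  have hne : ∀ᶠ N : ℕ in atTop, C * (N : ℝ) ^ σ ≠ 0 := by
    filter_upwards [eventually_gt_atTop 0] with N hN
    have : (0 : ℝ) < N := by exact_mod_cast hN
    positivity
  rw [isEquivalent_iff_tendsto_one hne]
  have := h.div_const C
  rw [div_self hC] at this
  refine this.congr fun N => ?_
  rw [Pi.div_apply, div_div, mul_comm C]

/-! ### Almost sure growth -/

lemma ae_tendsto_zero_of_tsum_lintegral_sq {Y : ℕ → Ω → ℝ} (hY : ∀ k, Measurable (Y k))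
    (hsum : ∑' k, ∫⁻ ω, ENNReal.ofReal (Y k ω ^ 2) ∂P ≠ ∞) :
    ∀ᵐ ω ∂P, Tendsto (fun k => Y k ω) atTop (𝓝 0) := by
  have hm : ∀ k, Measurable fun ω => ENNReal.ofReal (Y k ω ^ 2) := fun k => by fun_prop
  rw [← lintegral_tsum fun k => (hm k).aemeasurable] at hsum
  filter_upwards [ae_lt_top (Measurable.tsum hm) hsum] with ω hω
  have h1 := ENNReal.tendsto_atTop_zero_of_tsum_ne_top hω.ne
  have h2 := (ENNReal.tendsto_toReal ENNReal.zero_ne_top).comp h1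
  have h3 : Tendsto (fun k => √(Y k ω ^ 2)) atTop (𝓝 √0) := by
    refine (h2.congr fun k => ?_).sqrt
    exact ENNReal.toReal_ofReal (sq_nonneg _)
  simp only [Real.sqrt_sq_eq_abs, Real.sqrt_zero] at h3
  exact (tendsto_zero_iff_abs_tendsto_zero _).2 h3

lemma monotone_nonzeroColumns {Ω : Type*} (Z : ℕ → ℕ → Ω → Bool) (ω : Ω) :
    Monotone fun N => nonzeroColumns Z N ω := fun _ _ h _ ⟨n, hn, hZ⟩ => ⟨n, hn.trans_le h, hZ⟩

variable {𝒱 : Type*} [MeasurableSpace 𝒱] {w : ℕ → Ω → ℝ} {θ : ℕ → Ω → 𝒱} {Z : ℕ → ℕ → Ω → Bool}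

lemma IsCliqueMatrix.measurable_ncard_nonzeroColumns (hZ : IsCliqueMatrix P w θ Z) (N : ℕ) :
    Measurable fun ω => ((nonzeroColumns Z N ω).ncard : ℝ) := by
  convert (hZ.measurable_encard_nonzeroColumns N).ennreal_toReal using 1
  funext ω
  by_cases h : (nonzeroColumns Z N ω).Finite
  · rw [← h.cast_ncard_eq]
    simp
  · rw [Set.Infinite.ncard h, Set.Infinite.encard_eq h]
    simp

lemma IsCliqueMatrix.ae_tendsto_ncard_nonzeroColumns [IsProbabilityMeasure P] {ν : Measure ℝ}
    [SigmaFinite ν] (hZ : IsCliqueMatrix P w θ Z) (hw : IsPoissonProcess ν P w)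
    (hν : ∀ᵐ x ∂ν, 0 ≤ x) {m : ℕ → ℝ} (hm0 : ∀ N, 0 ≤ m N)
    (hm : ∀ N, ∫⁻ x, hitProb N x ∂ν = ENNReal.ofReal (m N)) {σ C : ℝ} (hσ : 0 < σ) (hC : 0 < C)
    (hlim : Tendsto (fun N : ℕ => m N / (N : ℝ) ^ σ) atTop (𝓝 C)) :
    ∀ᵐ ω ∂P, Tendsto (fun N : ℕ => ((nonzeroColumns Z N ω).ncard : ℝ) / (N : ℝ) ^ σ)
      atTop (𝓝 C) := by
  -- Along `N = k ^ p` with `p σ ≥ 2` the relative variances `1 / m N` are summable.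
  obtain ⟨p, hp⟩ := exists_nat_ge (2 / σ)
  have hp0 : p ≠ 0 := by
    rintro rfl
    have : 0 < 2 / σ := by positivity
    simp only [Nat.cast_zero] at hp
    linarith
  have hpσ : 2 ≤ p * σ := (div_le_iff₀ hσ).1 hp
  have hsub : Tendsto (fun k : ℕ => k ^ p) atTop atTop := tendsto_pow_atTop hp0
  have hlim' := hlim.comp hsub
  have hlow : ∀ᶠ k : ℕ in atTop, C / 2 * (k : ℝ) ^ 2 ≤ m (k ^ p) := by
    filter_upwards [hlim'.eventually_const_le (half_lt_self hC), eventually_ge_atTop 1]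
      with k hk hk1
    have hk1' : (1 : ℝ) ≤ k := by exact_mod_cast hk1
    have hkp : (0 : ℝ) < ((k ^ p : ℕ) : ℝ) ^ σ := by positivity
    rw [Function.comp, le_div_iff₀ hkp] at hk
    refine le_trans (mul_le_mul_of_nonneg_left ?_ (by positivity)) hk
    push_cast
    rw [← Real.rpow_natCast_mul (by positivity), ← Real.rpow_two]
    exact Real.rpow_le_rpow_of_exponent_le hk1' hpσ
  have hpos : ∀ᶠ k : ℕ in atTop, 0 < m (k ^ p) := by
    filter_upwards [hlow, eventually_gt_atTop 0] with k hk hk0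
    have : (0 : ℝ) < k := by exact_mod_cast hk0
    exact lt_of_lt_of_le (by positivity) hk
  have hsummable : Summable fun k : ℕ => (m (k ^ p))⁻¹ := by
    have hs : Summable fun k : ℕ => (C / 2)⁻¹ * (1 / (k : ℝ) ^ 2) :=
      (Real.summable_one_div_nat_pow.2 one_lt_two).mul_left _
    refine hs.of_norm_bounded_eventually_nat ?_
    filter_upwards [hlow, hpos, eventually_gt_atTop 0] with k hk hk' hk0
    have : (0 : ℝ) < k := by exact_mod_cast hk0
    rw [Real.norm_of_nonneg (inv_nonneg.2 hk'.le), one_div, ← mul_inv]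
    exact inv_anti₀ (by positivity) hk
  set Y : ℕ → Ω → ℝ := fun k ω =>
    ((nonzeroColumns Z (k ^ p) ω).ncard - m (k ^ p)) / m (k ^ p) with hY
  have hYm : ∀ k, Measurable (Y k) := fun k =>
    ((hZ.measurable_ncard_nonzeroColumns _).sub_const _).div_const _
  have hYint : ∀ k, ∫⁻ ω, ENNReal.ofReal (Y k ω ^ 2) ∂P = ENNReal.ofReal (m (k ^ p))⁻¹ := by
    intro k
    have hmk := hm0 (k ^ p)
    have hv := hZ.lintegral_ncard_nonzeroColumns_sub_sq hw hν hmk (hm (k ^ p))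
    have hme := hZ.measurable_ncard_nonzeroColumns (k ^ p)
    have e : ∀ ω, ENNReal.ofReal (Y k ω ^ 2) = ENNReal.ofReal ((m (k ^ p) ^ 2)⁻¹) *
        ENNReal.ofReal (((nonzeroColumns Z (k ^ p) ω).ncard - m (k ^ p)) ^ 2) := by
      intro ω
      rw [← ENNReal.ofReal_mul (by positivity), hY]
      congr 1
      rw [div_pow, div_eq_inv_mul]
    simp only [e]
    rw [lintegral_const_mul _ (by fun_prop), hv, ← ENNReal.ofReal_mul (by positivity)]
    congr 1
    rcases hmk.eq_or_lt with h | h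
    · simp [← h]
    · field_simp
  have hYsum : ∑' k, ∫⁻ ω, ENNReal.ofReal (Y k ω ^ 2) ∂P ≠ ∞ := by
    simp only [hYint]
    exact hsummable.tsum_ofReal_ne_top
  have hfin : ∀ᵐ ω ∂P, ∀ N, (nonzeroColumns Z N ω).Finite :=
    ae_all_iff.2 fun N => hZ.ae_finite_nonzeroColumns hw hν (hm N ▸ ENNReal.ofReal_ne_top)
  filter_upwards [ae_tendsto_zero_of_tsum_lintegral_sq hYm hYsum, hfin] with ω hω hωfin
  refine tendsto_div_rpow_of_monotone
    (fun M N hMN => by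
      exact_mod_cast Set.ncard_le_ncard (monotone_nonzeroColumns Z ω hMN) (hωfin N))
    (fun N => by positivity) hσ hp0 ?_
  have h1 := (hω.add_const 1).mul hlim'
  rw [zero_add, one_mul] at h1
  refine h1.congr' ?_
  filter_upwards [hpos] with k hk
  simp only [hY, Function.comp]
  field_simp
  ring

/-! ### Vertices and non-zero columns -/

lemma vertexSet_eq_image {Ω 𝒱 : Type*} (θ : ℕ → Ω → 𝒱) (Z : ℕ → ℕ → Ω → Bool) (N : ℕ) (ω : Ω) :
    vertexSet θ Z N ω = (fun i => θ i ω) '' nonzeroColumns Z N ω := by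
  ext v
  simp only [vertexSet, clique, nonzeroColumns, Set.mem_ofPred_eq, Set.mem_image]
  exact ⟨fun ⟨n, hn, i, hi, hv⟩ => ⟨i, ⟨n, hn, hi⟩, hv⟩,
    fun ⟨i, ⟨n, hn, hi⟩, hv⟩ => ⟨n, hn, i, hi, hv⟩⟩

lemma ae_injective_of_iIndepFun [IsProbabilityMeasure P] [StandardBorelSpace 𝒱] {H : Measure 𝒱}
    [IsProbabilityMeasure H] [NullSingletonClass H] (hm : ∀ i, Measurable (θ i))
    (hlaw : ∀ i, P.map (θ i) = H) (hind : iIndepFun θ P) :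
    ∀ᵐ ω ∂P, Function.Injective fun i => θ i ω := by
  have hne : ∀ i j, i ≠ j → ∀ᵐ ω ∂P, θ i ω ≠ θ j ω := by
    intro i j hij
    have h1 : P.map (fun ω => (θ i ω, θ j ω)) = H.prod H := by
      rw [(indepFun_iff_map_prod_eq_prod_map_map (hm i).aemeasurable (hm j).aemeasurable).1
        (hind.indepFun hij), hlaw, hlaw]
    have h2 : (H.prod H) (Set.diagonal 𝒱) = 0 := by
      rw [Measure.prod_apply measurableSet_diagonal]
      simp [Set.preimage, Set.diagonal]
    rw [← h1, Measure.map_apply ((hm i).prodMk (hm j)) measurableSet_diagonal] at h2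
    rw [ae_iff]
    convert h2 using 2
    ext ω
    simp
  have hall : ∀ᵐ ω ∂P, ∀ i j, i ≠ j → θ i ω ≠ θ j ω :=
    ae_all_iff.2 fun i => ae_all_iff.2 fun j => by
      by_cases hij : i = j
      · simp [hij]
      · filter_upwards [hne i j hij] with ω hω _ using hω
  filter_upwards [hall] with ω hω i j hij
  by_contra h
  exact hω i j h hij

end RandomCliqueCover

open RandomCliqueCover in
theorem proposition1
    {Ω : Type*} [MeasurableSpace Ω] (P : Measure Ω) [IsProbabilityMeasure P]
    {𝒱 : Type*} [MeasurableSpace 𝒱] [StandardBorelSpace 𝒱]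
    (H : Measure 𝒱) [IsProbabilityMeasure H] [NullSingletonClass H]
    (c σ α : ℝ) (hσ0 : 0 < σ) (hσ1 : σ < 1) (hc : -σ < c) (hα : 0 < α)
    (w : ℕ → Ω → ℝ) (θ : ℕ → Ω → 𝒱) (Z : ℕ → ℕ → Ω → Bool)
    (hSB : IsStableBetaProcess c σ α H P w θ) (hZ : IsCliqueMatrix P w θ Z) :
    -- almost surely, the number of vertices is asymptotic to the power law
    (∀ᵐ ω ∂P, (∀ N : ℕ, (vertexSet θ Z N ω).Finite) ∧
      (fun N : ℕ => ((vertexSet θ Z N ω).ncard : ℝ))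
        ~[atTop] fun N : ℕ => growthConst c σ α * (N : ℝ) ^ σ) ∧
    -- so is the expected number of vertices
    ((∀ N : ℕ, ∫⁻ ω, ((vertexSet θ Z N ω).encard : ℝ≥0∞) ∂P ≠ ∞) ∧
      (fun N : ℕ => (∫⁻ ω, ((vertexSet θ Z N ω).encard : ℝ≥0∞) ∂P).toReal)
        ~[atTop] fun N : ℕ => growthConst c σ α * (N : ℝ) ^ σ) ∧
    -- and the expected number of non-zero columns of the matrix
    ((∀ N : ℕ, ∫⁻ ω, ((nonzeroColumns Z N ω).encard : ℝ≥0∞) ∂P ≠ ∞) ∧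
      (fun N : ℕ => (∫⁻ ω, ((nonzeroColumns Z N ω).encard : ℝ≥0∞) ∂P).toReal)
        ~[atTop] fun N : ℕ => growthConst c σ α * (N : ℝ) ^ σ) := by
  have hC := growthConst_pos hσ0 hσ1 hc hα
  have hν : ∀ᵐ x ∂(stableBetaLevy c σ α), 0 ≤ x :=
    (ae_mem_Ioc_stableBetaLevy c σ α).mono fun x hx => hx.1.le
  have hm : ∀ N, ∫⁻ x, hitProb N x ∂(stableBetaLevy c σ α) =
      ENNReal.ofReal (meanColumns c σ α N) :=
    lintegral_one_sub_pow_stableBetaLevy hσ1 hc hα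
  have hm0 := meanColumns_nonneg hσ1 hc hα
  have hlim := tendsto_meanColumns_div α hσ0 hσ1 hc
  have hinj := ae_injective_of_iIndepFun hSB.measurable_location hSB.law_location
    hSB.iIndep_location
  have hcols : ∀ N, ∫⁻ ω, ((nonzeroColumns Z N ω).encard : ℝ≥0∞) ∂P =
      ENNReal.ofReal (meanColumns c σ α N) := fun N => by
    rw [hZ.lintegral_encard_nonzeroColumns hSB.weights hν, hm]
  have hverts : ∀ N, ∫⁻ ω, ((vertexSet θ Z N ω).encard : ℝ≥0∞) ∂P =
      ENNReal.ofReal (meanColumns c σ α N) := fun N => by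
    rw [← hcols]
    refine lintegral_congr_ae (hinj.mono fun ω hω => ?_)
    simp only [vertexSet_eq_image, hω.encard_image]
  have hmean : (fun N => (ENNReal.ofReal (meanColumns c σ α N)).toReal)
      ~[atTop] fun N : ℕ => growthConst c σ α * (N : ℝ) ^ σ := by
    simp only [ENNReal.toReal_ofReal (hm0 _)]
    exact isEquivalent_of_tendsto_div_rpow hC.ne' hlim
  simp only [hcols, hverts]
  refine ⟨?_, ⟨fun N => ENNReal.ofReal_ne_top, hmean⟩, ⟨fun N => ENNReal.ofReal_ne_top, hmean⟩⟩
  have hfin : ∀ᵐ ω ∂P, ∀ N, (nonzeroColumns Z N ω).Finite := ae_all_iff.2 fun N =>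
    hZ.ae_finite_nonzeroColumns hSB.weights hν (hm N ▸ ENNReal.ofReal_ne_top)
  filter_upwards [hinj, hfin,
    hZ.ae_tendsto_ncard_nonzeroColumns hSB.weights hν hm0 hm hσ0 hC hlim] with ω h₁ h₂ h₃
  simp only [vertexSet_eq_image, Set.ncard_image_of_injective _ h₁]
  exact ⟨fun N => (h₂ N).image _, isEquivalent_of_tendsto_div_rpow hC.ne' h₃⟩
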